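/- Let $k$ be a field and let $C\subset\mathbb P^4_k$ be a curve, i.e. a closed subscheme of dimension $1$, of degree $8$ and arithmetic genus $4$; that is, the Hilbert polynomial of $C$ is $8n+1-4$. Suppose that $C$ is arithmetically Cohen–Macaulay (ACM): its homogeneous coordinate ring $k[x_0,\dots,x_4]/I(C)$ is a Cohen–Macaulay ring, where $I(C)$ is the homogeneous ideal generated by all forms vanishing on $C$. Let $\mathcal I_C\subset\mathcal O_{\mathbb P^4_k}$ be the ideal sheaf of $C$. Then $$h^0\bigl(\mathbb P^4_k,\mathcal I_C(2)\bigr)=\dim_k H^0\bigl(\mathbb P^4_k,\mathcal I_C(2)\bigr)=2.$$ In particular, $C$ is contained (as a subscheme) in a quadric hypersurface: there is a nonzero quadratic form $q\in k[x_0,\dots,x_4]$ such that $C$ is a closed subscheme of the hypersurface $V(q)\subset\mathbb P^4_k$. -/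

import Mathlib

open AlgebraicGeometry CategoryTheory MvPolynomial

noncomputable section

namespace ACMCurve

universe u

attribute [local instance] MvPolynomial.gradedAlgebra

/-! ### Cohen-Macaulay rings -/

/-- A Noetherian local ring is Cohen-Macaulay if its maximal ideal contains a regular sequence
whose length is the Krull dimension of the ring (that is, depth equals dimension). -/
structure IsCohenMacaulayLocalRing (R : Type u) [CommRing R] [IsLocalRing R] : Prop where
  noetherian : IsNoetherianRing R
  exists_regular : ∃ rs : List R, (∀ r ∈ rs, r ∈ IsLocalRing.maximalIdeal R) ∧
    RingTheory.Sequence.IsRegular R rs ∧ ((rs.length : ℕ) : WithBot ℕ∞) = ringKrullDim R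

/-- A Noetherian ring is Cohen-Macaulay if its localization at every maximal ideal is. -/
structure IsCohenMacaulayRing (R : Type u) [CommRing R] : Prop where
  noetherian : IsNoetherianRing R
  localization : ∀ (m : Ideal R) [m.IsMaximal], IsCohenMacaulayLocalRing (Localization.AtPrime m)

/-! ### Projective space and twisted ideal sheaves -/

/-- Projective space of dimension `r` over `k`, i.e. `Proj k[x₀, …, x_r]` with the standard
grading. -/
abbrev ProjSpace (r : ℕ) (k : Type u) [Field k] : Scheme.{u} :=
  Proj (homogeneousSubmodule (Fin (r + 1)) k)

variable {r : ℕ} {k : Type u} [Field k]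

/-- The homogeneous prime ideal of a point of projective space. -/
abbrev primeAt (y : ProjSpace r k) : Ideal (MvPolynomial (Fin (r + 1)) k) :=
  (ProjectiveSpectrum.asHomogeneousIdeal
    (𝒜 := homogeneousSubmodule (Fin (r + 1)) k) y).toIdeal

instance isPrime_primeAt (y : ProjSpace r k) : (primeAt y).IsPrime :=
  ProjectiveSpectrum.isPrime (𝒜 := homogeneousSubmodule (Fin (r + 1)) k) y

/-- The localization `k[x₀, …, x_r]_𝔭` at the homogeneous prime `𝔭` of a point of
projective space. The stalk of `𝒪(n)` at the point is its part of degree `n`. -/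
abbrev LocAt (y : ProjSpace r k) : Type u :=
  Localization.AtPrime (primeAt y)

/-- The standard affine open `D₊(x_i)`. -/
abbrev chart (r : ℕ) (k : Type u) [Field k] (i : Fin (r + 1)) : (ProjSpace r k).Opens :=
  Proj.basicOpen (homogeneousSubmodule (Fin (r + 1)) k) (X i)

/-- The value of a section of the structure sheaf at a point, as an element of the (degree zero
part of the) localization `k[x₀, …, x_r]_𝔭`. -/
def valueAt {U : (ProjSpace r k).Opens} (y : ProjSpace r k) (hy : y ∈ U) :
    Γ(ProjSpace r k, U) →+* LocAt y :=
  (algebraMap (HomogeneousLocalization.AtPrime (homogeneousSubmodule (Fin (r + 1)) k) (primeAt y))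
    (LocAt y)).comp
    (openToLocalization (homogeneousSubmodule (Fin (r + 1)) k) U y hy).hom

/-- The constant section with value `c` has value `c` at every point. -/
lemma valueAt_const (i : Fin (r + 1)) (c : k)
    (hc : (C c : MvPolynomial (Fin (r + 1)) k) ∈ homogeneousSubmodule (Fin (r + 1)) k 0)
    (y : ProjSpace r k) (hy : y ∈ chart r k i) :
    valueAt y hy ((Proj.awayToSection (homogeneousSubmodule (Fin (r + 1)) k) (X i)).hom
      (HomogeneousLocalization.fromZeroRingHom _ _ ⟨C c, hc⟩)) =
    algebraMap (MvPolynomial (Fin (r + 1)) k) (LocAt y) (C c) := by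
  exact Localization.mk_one_eq_algebraMap (M := (primeAt y).primeCompl) _

/-- The sections over `U` of the ideal sheaf of `ι : Z ⟶ ℙ^r`, the kernel of
`𝒪_{ℙ^r} → ι_* 𝒪_Z`. -/
def idealSections {Z : Scheme.{u}} (ι : Z ⟶ ProjSpace r k) (U : (ProjSpace r k).Opens) :
    Ideal Γ(ProjSpace r k, U) :=
  RingHom.ker (ι.app U).hom

/-- `H⁰(ℙ^r, ℐ_Z(n))` as a `k`-vector space. As in the description of the structure sheaf of
`Proj`, a section of `𝒪(n)` is a family `s` of elements of the localizations at the points.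
On `D₊(x_i)` the sheaf `𝒪(n)` is free on `x_i ^ n`, so that `ℐ_Z(n)` is `ℐ_Z · x_i ^ n` there. -/
def twistedIdealSections {Z : Scheme.{u}} (ι : Z ⟶ ProjSpace r k) (n : ℕ) :
    Submodule k (∀ y : ProjSpace r k, LocAt y) where
  carrier := {s | ∀ i, ∃ t ∈ idealSections ι (chart r k i), ∀ y (hy : y ∈ chart r k i),
    s y = valueAt y hy t * algebraMap (MvPolynomial (Fin (r + 1)) k) (LocAt y) (X i ^ n)}
  zero_mem' := by
    intro i
    refine ⟨0, zero_mem _, fun y hy => ?_⟩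
    simp
  add_mem' := by
    intro s s' hs hs' i
    obtain ⟨t, ht, h⟩ := hs i
    obtain ⟨t', ht', h'⟩ := hs' i
    refine ⟨t + t', add_mem ht ht', fun y hy => ?_⟩
    rw [Pi.add_apply, h y hy, h' y hy, map_add, add_mul]
  smul_mem' := by
    intro c s hs i
    obtain ⟨t, ht, h⟩ := hs i
    have hc : (C c : MvPolynomial (Fin (r + 1)) k) ∈ homogeneousSubmodule (Fin (r + 1)) k 0 :=
      isHomogeneous_C _ _
    refine ⟨(Proj.awayToSection _ (X i)).hom
      (HomogeneousLocalization.fromZeroRingHom _ _ ⟨C c, hc⟩) * t,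
      Ideal.mul_mem_left _ _ ht, fun y hy => ?_⟩
    rw [Pi.smul_apply, h y hy, map_mul, valueAt_const, mul_assoc, ← Algebra.smul_def,
      ← algebraMap_eq, algebraMap_smul]

/-- `h⁰(ℐ_Z(n))`. -/
def h0TwistedIdeal {Z : Scheme.{u}} (ι : Z ⟶ ProjSpace r k) (n : ℕ) : ℕ :=
  Module.finrank k (twistedIdealSections ι n)

/-! ### Homogeneous coordinate ring, Hilbert polynomial, curves -/

/-- A form `f` of degree `n`, regarded as a global section of `𝒪(n)`, lies in `ℐ_Z(n)`;
in other words, `f` vanishes on the subscheme `Z`. -/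
def VanishesOn {Z : Scheme.{u}} (ι : Z ⟶ ProjSpace r k) (n : ℕ)
    (f : MvPolynomial (Fin (r + 1)) k) : Prop :=
  (fun y => algebraMap (MvPolynomial (Fin (r + 1)) k) (LocAt y) f) ∈ twistedIdealSections ι n

/-- The (saturated) homogeneous ideal of `Z` in `k[x₀, …, x_r]`, generated by all forms that
vanish on `Z`. -/
def homogeneousIdealOf {Z : Scheme.{u}} (ι : Z ⟶ ProjSpace r k) :
    Ideal (MvPolynomial (Fin (r + 1)) k) :=
  Ideal.span {f | ∃ n, f ∈ homogeneousSubmodule (Fin (r + 1)) k n ∧ VanishesOn ι n f}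

/-- The homogeneous coordinate ring of `Z`. -/
abbrev CoordinateRing {Z : Scheme.{u}} (ι : Z ⟶ ProjSpace r k) : Type u :=
  MvPolynomial (Fin (r + 1)) k ⧸ homogeneousIdealOf ι

/-- `Z` is arithmetically Cohen-Macaulay: its homogeneous coordinate ring is Cohen-Macaulay. -/
def IsACM {Z : Scheme.{u}} (ι : Z ⟶ ProjSpace r k) : Prop :=
  IsCohenMacaulayRing (CoordinateRing ι)

/-- The Hilbert function: the dimension of the degree `n` part of the coordinate ring. -/
def hilbertFunction {Z : Scheme.{u}} (ι : Z ⟶ ProjSpace r k) (n : ℕ) : ℕ :=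
  Module.finrank k ((homogeneousSubmodule (Fin (r + 1)) k n).map
    (Ideal.Quotient.mkₐ k (homogeneousIdealOf ι)).toLinearMap)

/-- `P` is the Hilbert polynomial of `Z`. -/
def IsHilbertPolynomial {Z : Scheme.{u}} (ι : Z ⟶ ProjSpace r k) (P : Polynomial ℚ) : Prop :=
  ∀ᶠ n : ℕ in Filter.atTop, P.eval (n : ℚ) = hilbertFunction ι n

/-- `ι : Z ⟶ ℙ^r` is a curve (a closed subscheme of dimension one) of degree `d` and arithmetic
genus `g`: its Hilbert polynomial is `d n + 1 - g`. -/
structure IsCurve {Z : Scheme.{u}} (ι : Z ⟶ ProjSpace r k) (d : ℕ) (g : ℤ) : Prop where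
  isClosedImmersion : IsClosedImmersion ι
  dim_eq_one : topologicalKrullDim Z = 1
  hilbertPolynomial : IsHilbertPolynomial ι
    (Polynomial.C (d : ℚ) * Polynomial.X + Polynomial.C (1 - (g : ℚ)))

/-! ### Hypersurfaces -/

/-- The ideal sheaf of the hypersurface `V(q)` of a form `q` of degree `d`: the smallest
quasi-coherent ideal sheaf `J` such that `q` is a section of `J(d)`. So `V(q)` is the largest
closed subscheme on which `q` vanishes. -/
def hypersurface (d : ℕ) (q : MvPolynomial (Fin (r + 1)) k) : (ProjSpace r k).IdealSheafData :=
  sInf {J | VanishesOn J.subschemeι d q}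

/-- `Z` is contained, as a subscheme, in a hypersurface of degree `d`: the morphism `ι` factors
through `V(q)` for some nonzero form `q` of degree `d`. -/
def LiesOnHypersurface {Z : Scheme.{u}} (ι : Z ⟶ ProjSpace r k) (d : ℕ) : Prop :=
  ∃ q ∈ homogeneousSubmodule (Fin (r + 1)) k d, q ≠ 0 ∧
    ∃ j : Z ⟶ (hypersurface d q).subscheme, j ≫ (hypersurface d q).subschemeι = ι

end ACMCurve

end

open AlgebraicGeometry CategoryTheory MvPolynomial

noncomputable section

namespace ACMCurve

universe u

/-! Let `A` be the homogeneous coordinate ring and `H` its Hilbert function. Since global sections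
of `𝒪(2)` are quadratic forms, `h⁰(ℐ_C(2))` is the dimension of the degree two part of `I(C)`, which
is `15 - H 2`. So the claim is `H 2 = 13`.

The Cohen–Macaulay hypothesis enters through convexity, `2 H(n+1) ≤ H(n+2) + H(n)`. Over an infinite
field one would choose two linear forms that form a regular sequence on `A`. Here `k` may be finite,
so two generic forms `l = ∑ x_i T^i` and `l' = ∑ x_i S^i` are used after extending scalars to
`k[T][S]`. Depth at least two at the irrelevant ideal is expressed as the vanishing of Koszul
cohomology of the coordinates in degrees zero and one (`koszulDepthTwo_of_isACM`). This makes the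
Koszul complex of `l, l'` exact in the middle (`KoszulDepthTwo.genericForm_exact`), and counting
ranks over `k[T][S]` gives convexity (`two_mul_finrank_le`).

By convexity the slopes of `H` increase to their eventual value 8. Hence `H n ≥ 8n - 3` for every
`n`, so `H 2 ≥ 13`. Also `H 2 ≤ H 1 + 8 ≤ 13`, since `H 1 ≤ 5` (`eq_thirteen_of_convex`). A nonzero
quadric in the ideal then gives the hypersurface. -/

/-- The Koszul cohomology of the family `x` on the ring `A` vanishes in degrees zero and one. -/
structure KoszulDepthTwo {A : Type*} [CommRing A] {σ : Type*} (x : σ → A) : Prop where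
  eq_zero : ∀ a, (∀ i, x i * a = 0) → a = 0
  exists_eq : ∀ c : σ → A, (∀ i j, x j * c i = x i * c j) → ∃ b, ∀ i, c i = x i * b

/-! ### Koszul vanishing from regular pairs and from a localization. -/

namespace KoszulDepthTwo

variable {A : Type*} [CommRing A] {σ : Type*} {x : σ → A}

lemma exists_sum_of_mem_span [Fintype σ] {a : A} (ha : a ∈ Ideal.span (Set.range x)) :
    ∃ e : σ → A, a = ∑ i, e i * x i := by
  obtain ⟨e, he⟩ := (Submodule.mem_span_range_iff_exists_fun A).1 ha
  exact ⟨e, by simpa using he.symm⟩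

/-- Write `r = ∑ α_j x_j` and `d = ∑ α_j c_j`. The cocycle condition gives `r c_i = x_i d`, so `r`
divides `s d`, hence `d = r b`, and cancelling `r` leaves `c_i = x_i b`. The regular pair only has
to lie in the ideal generated by `x`; it need not consist of members of `x`. -/
lemma of_regular [Fintype σ] {r s : A} (hr : r ∈ Ideal.span (Set.range x))
    (hs : s ∈ Ideal.span (Set.range x)) (hreg : ∀ a, r * a = 0 → a = 0)
    (hreg' : ∀ a, r ∣ s * a → r ∣ a) : KoszulDepthTwo x := by
  obtain ⟨α, rfl⟩ := exists_sum_of_mem_span hr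
  obtain ⟨β, rfl⟩ := exists_sum_of_mem_span hs
  refine ⟨fun a ha => hreg a ?_, fun c hc => ?_⟩
  · simp [Finset.sum_mul, mul_assoc, ha]
  · have key : ∀ i, (∑ j, α j * x j) * c i = x i * ∑ j, α j * c j := by
      intro i
      rw [Finset.sum_mul, Finset.mul_sum]
      refine Finset.sum_congr rfl fun j _ => ?_
      rw [mul_assoc, hc i j, mul_left_comm]
    obtain ⟨b, hb⟩ := hreg' (∑ j, α j * c j) (by
      rw [Finset.sum_mul]
      refine Finset.dvd_sum fun i _ => ?_
      rw [mul_assoc, ← key]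
      exact ⟨β i * c i, by ring⟩)
    refine ⟨b, fun i => sub_eq_zero.1 (hreg _ ?_)⟩
    rw [mul_sub, key, hb]
    ring

/-- Koszul cohomology of `x` is annihilated by the ideal `m` that `x` generates, so elements outside
`m` act invertibly on it and localizing at `m` loses nothing. -/
lemma of_localization [Fintype σ] (m : Ideal A) [m.IsMaximal]
    (hm : m = Ideal.span (Set.range x))
    (h : KoszulDepthTwo fun i => algebraMap A (Localization.AtPrime m) (x i)) :
    KoszulDepthTwo x := by
  have unit_of (s : m.primeCompl) : ∃ t : A, ∃ e : σ → A, t * s.1 = 1 - ∑ i, e i * x i := by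
    obtain ⟨t, w, hw, ht⟩ := Ideal.IsMaximal.exists_inv (inferInstance : m.IsMaximal) s.2
    obtain ⟨e, rfl⟩ := exists_sum_of_mem_span (hm ▸ hw)
    exact ⟨t, e, by rw [← ht]; ring⟩
  refine ⟨fun a ha => ?_, fun c hc => ?_⟩
  · have := h.eq_zero (algebraMap A _ a) fun i => by rw [← map_mul, ha, map_zero]
    rw [IsLocalization.map_eq_zero_iff m.primeCompl] at this
    obtain ⟨s, hs⟩ := this
    obtain ⟨t, e, ht⟩ := unit_of s
    have h1 : t * s.1 * a = 0 := by rw [mul_assoc, hs, mul_zero]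
    rw [ht, sub_mul, Finset.sum_mul, one_mul] at h1
    simpa [mul_assoc, ha] using h1
  · obtain ⟨b, hb⟩ := h.exists_eq (fun i => algebraMap A _ (c i)) fun i j => by
      rw [← map_mul, ← map_mul, hc]
    obtain ⟨⟨b, s⟩, rfl⟩ := IsLocalization.mk'_surjective m.primeCompl b
    have h1 : ∀ i, ∃ w : m.primeCompl, w.1 * (s.1 * c i) = w.1 * (x i * b) := by
      intro i
      refine (IsLocalization.eq_iff_exists m.primeCompl (Localization.AtPrime m)).1 ?_
      rw [map_mul, map_mul, hb i, mul_left_comm, IsLocalization.mk'_spec']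
    choose w hw using h1
    classical
    -- The product of the finitely many `w i` clears all denominators at once.
    obtain ⟨t, e, ht⟩ := unit_of ((∏ i, w i) * s)
    have h2 : ∀ i, (1 - ∑ j, e j * x j) * c i = x i * (t * (∏ i, (w i).1) * b) := by
      intro i
      have h3 : (∏ j, (w j).1) * (s.1 * c i) = (∏ j, (w j).1) * (x i * b) := by
        rw [← Finset.mul_prod_erase _ _ (Finset.mem_univ i)]
        linear_combination (∏ j ∈ Finset.univ.erase i, (w j).1) * hw i
      rw [← ht]
      push_cast
      linear_combination t * h3
    -- Split `c i` as `(1 - ∑ e_j x_j) c_i + (∑ e_j x_j) c_i`; each summand is `x_i` times an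
    -- element independent of `i`.
    refine ⟨t * (∏ i, (w i).1) * b + ∑ j, e j * c j, fun i => ?_⟩
    have h4 : (∑ j, e j * x j) * c i = x i * ∑ j, e j * c j := by
      rw [Finset.sum_mul, Finset.mul_sum]
      refine Finset.sum_congr rfl fun j _ => ?_
      rw [mul_assoc, hc i j, mul_left_comm]
    linear_combination h2 i + h4

end KoszulDepthTwo

/-! ### Generic linear forms and exactness of their Koszul complex. -/

section GenericForm

open Polynomial in
/-- The generic linear combination `∑ i, x i * T ^ i`. -/
def genericForm {A : Type*} [CommRing A] {m : ℕ} (x : Fin m → A) : A[X] :=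
  ∑ i, Polynomial.C (x i) * Polynomial.X ^ (i : ℕ)

variable {A : Type*} [CommRing A] {m : ℕ} {x : Fin m → A}

lemma coeff_genericForm (i : Fin m) : (genericForm x).coeff i = x i := by
  simp only [genericForm, Polynomial.finsetSum_coeff, Polynomial.coeff_C_mul_X_pow]
  rw [Finset.sum_eq_single i] <;> simp +contextual [Fin.ext_iff, eq_comm]

/-- McCoy's theorem: a zero divisor in `A[X]` is killed by a nonzero constant, and a constant
killing the generic form kills every `x i`. -/
lemma genericForm_mul_eq_zero (hx : ∀ a, (∀ i, x i * a = 0) → a = 0) {f : Polynomial A}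
    (hf : genericForm x * f = 0) : f = 0 := by
  have : genericForm x ∈ nonZeroDivisors (Polynomial A) := by
    rw [Polynomial.mem_nonZeroDivisors_iff]
    intro a ha
    refine hx a fun i => ?_
    have := congrArg (fun p => p.coeff (i : ℕ)) ha
    simpa [coeff_genericForm, mul_comm] using this
  exact (mul_left_mem_nonZeroDivisors_eq_zero_iff this).1 hf

-- The forms `l` (inner variable) and `l'` (outer variable) behave as a regular sequence: `l` is a
-- nonzerodivisor by McCoy, and so is `l'` modulo `l`, because the vanishing in degree one shows
-- that no nonzero element of `A[X]/(l)` is killed by all `x i`.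
open Polynomial in
lemma KoszulDepthTwo.genericForm_exact (h : KoszulDepthTwo x) {f g : A[X][X]}
    (hfg : Polynomial.C (genericForm x) * f + genericForm (fun i => Polynomial.C (x i)) * g = 0) :
    ∃ b : A[X][X], f = - (genericForm (fun i => Polynomial.C (x i)) * b) ∧
      g = Polynomial.C (genericForm x) * b := by
  set l := genericForm x
  have hl : ∀ p : A[X], l * p = 0 → p = 0 := fun p => genericForm_mul_eq_zero h.eq_zero
  have hx' : ∀ p : A[X], (∀ i, Polynomial.C (x i) * p = 0) → p = 0 := by
    intro p hp
    ext n
    refine h.eq_zero _ fun i => ?_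
    simpa using congrArg (fun q => q.coeff n) (hp i)
  let J : Ideal A[X] := Ideal.span {l}
  -- the irrelevant ideal has no nonzero annihilated element modulo `l`
  have hsoc : ∀ p : A[X] ⧸ J,
      (∀ i, Ideal.Quotient.mk J (Polynomial.C (x i)) * p = 0) → p = 0 := by
    intro p hp
    obtain ⟨p, rfl⟩ := Ideal.Quotient.mk_surjective p
    have h1 : ∀ i, ∃ c, Polynomial.C (x i) * p = l * c := by
      intro i
      have := hp i
      rw [← map_mul, Ideal.Quotient.eq_zero_iff_mem, Ideal.mem_span_singleton] at this
      exact this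
    choose c hc using h1
    have h2 : ∀ i j, Polynomial.C (x j) * c i = Polynomial.C (x i) * c j := by
      intro i j
      refine sub_eq_zero.1 (hl _ ?_)
      linear_combination Polynomial.C (x i) * hc j - Polynomial.C (x j) * hc i
    have h3 : ∀ n, ∃ b, ∀ i, (c i).coeff n = x i * b := fun n =>
      h.exists_eq (fun i => (c i).coeff n) fun i j => by
        simpa using congrArg (fun q => q.coeff n) (h2 i j)
    choose b hb using h3
    -- The `b n` are chosen degree by degree; truncating at a common degree bound `N` turns them
    -- into a polynomial, and beyond it all `c i` have zero coefficients.
    let N := Finset.univ.sup fun i => (c i).natDegree + 1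
    let q : A[X] := ∑ n ∈ Finset.range N, Polynomial.C (b n) * Polynomial.X ^ n
    have hq : ∀ i, c i = Polynomial.C (x i) * q := by
      intro i
      ext n
      simp only [q, Polynomial.coeff_C_mul, Polynomial.finsetSum_coeff,
        Polynomial.coeff_X_pow, mul_ite, mul_one, mul_zero, Finset.sum_ite_eq, Finset.mem_range]
      split_ifs with hn
      · exact hb n i
      · refine Polynomial.coeff_eq_zero_of_natDegree_lt ?_
        have : (c i).natDegree + 1 ≤ N :=
          Finset.le_sup (f := fun i => (c i).natDegree + 1) (Finset.mem_univ i)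
        omega
    rw [Ideal.Quotient.eq_zero_iff_mem, Ideal.mem_span_singleton]
    refine ⟨q, sub_eq_zero.1 (hx' _ fun i => ?_)⟩
    linear_combination hc i + l * hq i
  -- Modulo `l` the relation reads `l' g = 0`, and the image of `l'` is again a generic form.
  have hg : g.map (Ideal.Quotient.mk J) = 0 := by
    refine genericForm_mul_eq_zero (x := fun i => Ideal.Quotient.mk J (Polynomial.C (x i))) hsoc ?_
    have := congrArg (Polynomial.map (Ideal.Quotient.mk J)) hfg
    have hl0 : Ideal.Quotient.mk J l = 0 :=
      Ideal.Quotient.eq_zero_iff_mem.2 (Ideal.mem_span_singleton_self l)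
    simpa [genericForm, hl0, Polynomial.map_sum] using this
  have hdvd : Polynomial.C l ∣ g := by
    rw [Polynomial.C_dvd_iff_dvd_coeff]
    intro n
    have := congrArg (fun q => q.coeff n) hg
    rw [← Ideal.mem_span_singleton]
    simpa [Polynomial.coeff_map, Ideal.Quotient.eq_zero_iff_mem] using this
  obtain ⟨b, rfl⟩ := hdvd
  refine ⟨b, ?_, rfl⟩
  rw [← sub_eq_zero]
  have h5 : Polynomial.C l * (f - -(genericForm (fun i => Polynomial.C (x i)) * b)) = 0 := by
    linear_combination hfg
  ext1 n
  refine hl _ ?_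
  simpa using congrArg (fun q => q.coeff n) h5

end GenericForm

/-- Rank–nullity is needed over `k[X][X]`, where kernel and range need not be free; over a domain
the rank is still additive. -/
lemma finrank_range_add_finrank_ker_of_isDomain {R M N : Type*} [CommRing R] [IsDomain R]
    [AddCommGroup M] [AddCommGroup N] [Module R M] [Module R N] [Module.Finite R M]
    (φ : M →ₗ[R] N) :
    Module.finrank R (LinearMap.range φ) + Module.finrank R (LinearMap.ker φ) =
      Module.finrank R M := by
  rw [← φ.quotKerEquivRange.finrank_eq]
  exact Submodule.finrank_quotient_add_finrank _

/-! ### Extension of scalars to two variables and the rank count. -/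

section Convexity

open Polynomial

variable (k : Type*) {A : Type*} [Field k] [CommRing A] [Algebra k A]

/-- Extension of scalars along the polynomial ring in two variables over `k`. -/
abbrev bivariateAlgebra : Algebra k[X][X] A[X][X] :=
  (Polynomial.mapRingHom (Polynomial.mapRingHom (algebraMap k A))).toAlgebra

attribute [local instance] bivariateAlgebra

lemma bivariate_smul_def (r : k[X][X]) (f : A[X][X]) :
    r • f = (r.map (Polynomial.mapRingHom (algebraMap k A))) * f := rfl

variable {k}

/-- The extension of scalars of a subspace `V` of `A` to bivariate polynomials. -/
def bivariateSpan (V : Submodule k A) : Submodule k[X][X] A[X][X] :=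
  Submodule.span _ ((fun a => Polynomial.C (Polynomial.C a)) '' (V : Set A))

lemma C_C_mem_bivariateSpan {V : Submodule k A} {a : A} (ha : a ∈ V) :
    Polynomial.C (Polynomial.C a) ∈ bivariateSpan V :=
  Submodule.subset_span ⟨a, ha, rfl⟩

lemma bivariate_C_C_smul (c : k) (a : A) :
    (Polynomial.C (Polynomial.C c) : k[X][X]) • (Polynomial.C (Polynomial.C a) : A[X][X]) =
      Polynomial.C (Polynomial.C (c • a)) := by
  simp [bivariate_smul_def, Algebra.smul_def (R := k)]

lemma linearIndependent_C_C {τ : Type*} {b : τ → A} (hb : LinearIndependent k b) :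
    LinearIndependent k[X][X] fun j => (Polynomial.C (Polynomial.C (b j)) : A[X][X]) := by
  classical
  rw [linearIndependent_iff'] at hb ⊢
  intro s g hg j hj
  ext m n
  refine hb s (fun j => ((g j).coeff m).coeff n) ?_ j hj
  have := congrArg (fun p => (p.coeff m).coeff n) hg
  simpa [bivariate_smul_def, Polynomial.finsetSum_coeff, Algebra.smul_def (R := k)] using this

lemma bivariateSpan_eq_span {τ : Type*} {V : Submodule k A} {b : τ → A}
    (hb : Submodule.span k (Set.range b) = V) :
    bivariateSpan V =
      Submodule.span k[X][X] (Set.range fun j => (Polynomial.C (Polynomial.C (b j)) : A[X][X])) := by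
  refine le_antisymm (Submodule.span_le.2 ?_) (Submodule.span_mono ?_)
  · rintro _ ⟨a, ha, rfl⟩
    subst hb
    induction ha using Submodule.span_induction with
    | mem a h =>
      obtain ⟨j, rfl⟩ := h
      exact Submodule.subset_span ⟨j, rfl⟩
    | zero => simp
    | add a a' _ _ h h' => simpa using add_mem h h'
    | smul c a _ h =>
      rw [SetLike.mem_coe] at h ⊢
      dsimp only at h ⊢
      rw [← bivariate_C_C_smul]
      exact Submodule.smul_mem _ _ h
  · rintro _ ⟨j, rfl⟩
    exact ⟨b j, hb ▸ Submodule.subset_span ⟨j, rfl⟩, rfl⟩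

/-- A basis of `V` is a basis of its extension of scalars. -/
def bivariateSpanBasis (V : Submodule k A) [FiniteDimensional k V] :
    Module.Basis (Fin (Module.finrank k V)) k[X][X] (bivariateSpan V) :=
  have hspan : Submodule.span k (Set.range fun j => (Module.finBasis k V j : A)) = V := by
    have := congrArg (Submodule.map V.subtype) (Module.finBasis k V).span_eq
    rw [Submodule.map_span, ← Set.range_comp, Submodule.map_subtype_top] at this
    exact this
  (Module.Basis.span (linearIndependent_C_C
    ((Module.finBasis k V).linearIndependent.map' V.subtype V.ker_subtype))).map
    (LinearEquiv.ofEq _ _ (bivariateSpan_eq_span hspan).symm)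

lemma finrank_bivariateSpan (V : Submodule k A) [FiniteDimensional k V] :
    Module.finrank k[X][X] (bivariateSpan V) = Module.finrank k V := by
  rw [Module.finrank_eq_card_basis (bivariateSpanBasis V), Fintype.card_fin]

instance (V : Submodule k A) [FiniteDimensional k V] :
    Module.Finite k[X][X] (bivariateSpan V) :=
  .of_basis (bivariateSpanBasis V)

instance (V : Submodule k A) [FiniteDimensional k V] :
    Module.Free k[X][X] (bivariateSpan V) :=
  .of_basis (bivariateSpanBasis V)

variable {m : ℕ} {x : Fin m → A} {V W : Submodule k A}

lemma C_genericForm_mul_mem (hVW : ∀ i, ∀ a ∈ V, x i * a ∈ W) {f : A[X][X]}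
    (hf : f ∈ bivariateSpan V) : Polynomial.C (genericForm x) * f ∈ bivariateSpan W := by
  induction hf using Submodule.span_induction with
  | mem f h =>
    obtain ⟨a, ha, rfl⟩ := h
    dsimp only
    rw [← map_mul, genericForm, Finset.sum_mul, map_sum]
    refine sum_mem fun i _ => ?_
    convert (bivariateSpan W).smul_mem (Polynomial.C (Polynomial.X ^ (i : ℕ)))
      (C_C_mem_bivariateSpan (hVW i a ha)) using 1
    simp [bivariate_smul_def]
    ring
  | zero => simp
  | add f g _ _ hf hg => rw [mul_add]; exact add_mem hf hg
  | smul r f _ h => rw [mul_smul_comm]; exact Submodule.smul_mem _ _ h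

lemma genericForm_C_mul_mem (hVW : ∀ i, ∀ a ∈ V, x i * a ∈ W) {f : A[X][X]}
    (hf : f ∈ bivariateSpan V) :
    genericForm (fun i => Polynomial.C (x i)) * f ∈ bivariateSpan W := by
  induction hf using Submodule.span_induction with
  | mem f h =>
    obtain ⟨a, ha, rfl⟩ := h
    dsimp only
    rw [genericForm, Finset.sum_mul]
    refine sum_mem fun i _ => ?_
    convert (bivariateSpan W).smul_mem (Polynomial.X ^ (i : ℕ))
      (C_C_mem_bivariateSpan (hVW i a ha)) using 1
    simp [bivariate_smul_def]
    ring
  | zero => simp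
  | add f g _ _ hf hg => rw [mul_add]; exact add_mem hf hg
  | smul r f _ h => rw [mul_smul_comm]; exact Submodule.smul_mem _ _ h

lemma mem_bivariateSpan_iff {f : A[X][X]} :
    f ∈ bivariateSpan V ↔ ∀ i j, (f.coeff i).coeff j ∈ V := by
  refine ⟨fun hf i j => ?_, fun hf => ?_⟩
  · obtain ⟨n, r, g, rfl⟩ := Submodule.mem_span_set'.1 hf
    rw [Polynomial.finsetSum_coeff, Polynomial.finsetSum_coeff]
    refine sum_mem fun t _ => ?_
    obtain ⟨a, ha, hat⟩ := (g t).2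
    have := V.smul_mem (((r t).coeff i).coeff j) ha
    simpa [← hat, bivariate_smul_def, Algebra.smul_def (R := k)] using this
  · rw [f.as_sum_range]
    refine sum_mem fun i _ => ?_
    rw [(f.coeff i).as_sum_range, map_sum]
    refine sum_mem fun j _ => ?_
    convert (bivariateSpan V).smul_mem (Polynomial.monomial i (Polynomial.monomial j (1 : k)))
      (C_C_mem_bivariateSpan (hf i j)) using 1
    simp [bivariate_smul_def, Polynomial.map_monomial, Polynomial.monomial_mul_C]

/-- Apply an additive map to all coefficients of a polynomial. -/
def coeffMap {B B' : Type*} [CommRing B] [CommRing B'] (p : B →+ B') : B[X] →+ B'[X] where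
  toFun f := ∑ i ∈ Finset.range (f.natDegree + 1), Polynomial.monomial i (p (f.coeff i))
  map_zero' := by simp
  map_add' f g := by
    ext n
    simp only [Polynomial.finsetSum_coeff, Polynomial.coeff_monomial, Polynomial.coeff_add,
      Finset.sum_ite_eq', Finset.mem_range, Order.lt_add_one_iff]
    have key (h : B[X]) : (if n ≤ h.natDegree then p (h.coeff n) else 0) = p (h.coeff n) := by
      split_ifs with hn
      · rfl
      · rw [Polynomial.coeff_eq_zero_of_natDegree_lt (by omega), map_zero]
    have := key (f + g)
    rw [Polynomial.coeff_add] at this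
    rw [key, key, this, map_add]

lemma coeff_coeffMap {B B' : Type*} [CommRing B] [CommRing B'] (p : B →+ B') (f : B[X]) (n : ℕ) :
    (coeffMap p f).coeff n = p (f.coeff n) := by
  change (∑ i ∈ Finset.range (f.natDegree + 1), Polynomial.monomial i (p (f.coeff i))).coeff n = _
  simp only [Polynomial.finsetSum_coeff, Polynomial.coeff_monomial, Finset.sum_ite_eq',
    Finset.mem_range]
  split_ifs with hn
  · rfl
  · rw [Polynomial.coeff_eq_zero_of_natDegree_lt (by omega), map_zero]

lemma coeffMap_genericForm_mul {p q : A →+ A} (hpq : ∀ i a, q (x i * a) = x i * p a) (f : A[X]) :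
    coeffMap q (genericForm x * f) = genericForm x * coeffMap p f := by
  simp only [genericForm, Finset.sum_mul, map_sum]
  refine Finset.sum_congr rfl fun i _ => ?_
  ext n
  rw [coeff_coeffMap, mul_assoc, mul_assoc, Polynomial.coeff_C_mul, Polynomial.coeff_C_mul,
    Polynomial.coeff_X_pow_mul', Polynomial.coeff_X_pow_mul']
  split_ifs
  · rw [hpq, coeff_coeffMap]
  · simp

/-- Multiplication by the generic form reflects the degree of bivariate polynomials. -/
lemma mem_bivariateSpan_of_mul_mem (hx : ∀ a, (∀ i, x i * a = 0) → a = 0)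
    (p q : A →ₗ[k] A) (hp : ∀ a, p a ∈ V) (hq : ∀ a ∈ W, q a = a)
    (hpq : ∀ i a, q (x i * a) = x i * p a) (b : A[X][X])
    (hb : Polynomial.C (genericForm x) * b ∈ bivariateSpan W) : b ∈ bivariateSpan V := by
  rw [mem_bivariateSpan_iff] at hb ⊢
  intro i j
  -- Since `q` fixes the coefficients of `l * b` and `q (l * b) = l * p b`, cancelling `l` gives `b
  -- = p b`.
  have h1 : coeffMap q.toAddMonoidHom (genericForm x * b.coeff i) = genericForm x * b.coeff i := by
    ext n
    rw [coeff_coeffMap]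
    exact hq _ (by simpa using hb i n)
  rw [coeffMap_genericForm_mul (p := p.toAddMonoidHom) hpq] at h1
  have h2 : coeffMap p.toAddMonoidHom (b.coeff i) = b.coeff i :=
    sub_eq_zero.1 (genericForm_mul_eq_zero hx (by rw [mul_sub, h1, sub_self]))
  rw [← h2, coeff_coeffMap]
  exact hp _

/-- Convexity of the Hilbert function in depth two. -/
theorem two_mul_finrank_le (h : KoszulDepthTwo x) (V₀ V₁ V₂ : Submodule k A)
    [FiniteDimensional k V₀] [FiniteDimensional k V₁] [FiniteDimensional k V₂]
    (h₁ : ∀ i, ∀ a ∈ V₀, x i * a ∈ V₁) (h₂ : ∀ i, ∀ a ∈ V₁, x i * a ∈ V₂)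
    (p q : A →ₗ[k] A) (hp : ∀ a, p a ∈ V₀) (hq : ∀ a ∈ V₁, q a = a)
    (hpq : ∀ i a, q (x i * a) = x i * p a) :
    2 * Module.finrank k V₁ ≤ Module.finrank k V₂ + Module.finrank k V₀ := by
  -- The Koszul complex `V₀ → V₁ × V₁ → V₂` after extension of scalars: `ψ b = (-l' b, l b)` and `φ
  -- (f, g) = l f + l' g`.
  let l : A[X][X] := Polynomial.C (genericForm x)
  let l' : A[X][X] := genericForm (fun i => Polynomial.C (x i))
  let φ : (bivariateSpan V₁ × bivariateSpan V₁) →ₗ[k[X][X]] bivariateSpan V₂ :=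
    LinearMap.codRestrict _
      ((LinearMap.mulLeft k[X][X] l ∘ₗ (bivariateSpan V₁).subtype).coprod
        (LinearMap.mulLeft k[X][X] l' ∘ₗ (bivariateSpan V₁).subtype))
      fun f => add_mem (C_genericForm_mul_mem h₂ f.1.2) (genericForm_C_mul_mem h₂ f.2.2)
  let ψ : bivariateSpan V₀ →ₗ[k[X][X]] (bivariateSpan V₁ × bivariateSpan V₁) :=
    LinearMap.prod
      (LinearMap.codRestrict _ (-(LinearMap.mulLeft k[X][X] l' ∘ₗ (bivariateSpan V₀).subtype))
        fun f => neg_mem (genericForm_C_mul_mem h₁ f.2))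
      (LinearMap.codRestrict _ (LinearMap.mulLeft k[X][X] l ∘ₗ (bivariateSpan V₀).subtype)
        fun f => C_genericForm_mul_mem h₁ f.2)
  have hker : LinearMap.ker φ ≤ LinearMap.range ψ := by
    rintro ⟨⟨f, hf⟩, ⟨g, hg⟩⟩ hfg
    have hfg' : l * f + l' * g = 0 := congrArg Subtype.val (LinearMap.mem_ker.1 hfg)
    obtain ⟨b, hb, rfl⟩ := h.genericForm_exact hfg'
    have hb' := mem_bivariateSpan_of_mul_mem h.eq_zero p q hp hq hpq b hg
    exact ⟨⟨b, hb'⟩, Prod.ext (Subtype.ext hb.symm) rfl⟩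
  have h3 := finrank_range_add_finrank_ker_of_isDomain (R := k[X][X])
    (M := bivariateSpan V₁ × bivariateSpan V₁) (N := bivariateSpan V₂) φ
  have h4 : Module.finrank k[X][X] (LinearMap.range φ) ≤ Module.finrank k V₂ := by
    rw [← finrank_bivariateSpan]
    exact Submodule.finrank_le _
  have h5 : Module.finrank k[X][X] (LinearMap.ker φ) ≤ Module.finrank k V₀ := by
    rw [← finrank_bivariateSpan]
    exact (Submodule.finrank_mono hker).trans (LinearMap.finrank_range_le ψ)
  rw [Module.finrank_prod, finrank_bivariateSpan] at h3
  omega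

end Convexity

-- Sections on the standard charts and the homogeneous ideal.

attribute [local instance] MvPolynomial.gradedAlgebra

variable {r : ℕ} {k : Type u} [Field k]

lemma X_mem_homogeneousSubmodule (i : Fin (r + 1)) :
    (X i : MvPolynomial (Fin (r + 1)) k) ∈ homogeneousSubmodule (Fin (r + 1)) k 1 :=
  isHomogeneous_X k i

lemma X_notMem_primeAt {i : Fin (r + 1)} {y : ProjSpace r k} (hy : y ∈ chart r k i) :
    (X i : MvPolynomial (Fin (r + 1)) k) ∉ primeAt y := hy

lemma isUnit_X {i : Fin (r + 1)} {y : ProjSpace r k} (hy : y ∈ chart r k i) :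
    IsUnit (algebraMap (MvPolynomial (Fin (r + 1)) k) (LocAt y) (X i)) :=
  IsLocalization.map_units (M := (primeAt y).primeCompl) (LocAt y) ⟨X i, X_notMem_primeAt hy⟩

lemma valueAt_awayToSection (i : Fin (r + 1)) (n : ℕ) (a : MvPolynomial (Fin (r + 1)) k)
    (ha : a ∈ homogeneousSubmodule (Fin (r + 1)) k (n • 1)) (y : ProjSpace r k)
    (hy : y ∈ chart r k i) :
    valueAt y hy ((Proj.awayToSection (homogeneousSubmodule (Fin (r + 1)) k) (X i)).hom
      (HomogeneousLocalization.Away.mk _ (X_mem_homogeneousSubmodule i) n a ha)) *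
        algebraMap (MvPolynomial (Fin (r + 1)) k) (LocAt y) (X i ^ n) =
      algebraMap (MvPolynomial (Fin (r + 1)) k) (LocAt y) a := by
  have hn : X i ^ n ∈ (primeAt y).primeCompl := Submonoid.pow_mem _ (X_notMem_primeAt hy) n
  have : valueAt y hy ((Proj.awayToSection (homogeneousSubmodule (Fin (r + 1)) k) (X i)).hom
      (HomogeneousLocalization.Away.mk _ (X_mem_homogeneousSubmodule i) n a ha)) =
      Localization.mk a ⟨X i ^ n, hn⟩ := rfl
  rw [this, Localization.mk_eq_mk']
  exact IsLocalization.mk'_spec (LocAt y) a ⟨X i ^ n, hn⟩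

/-- A form `a` of degree `n` defines the section `a / x_i ^ n` on a standard chart. -/
lemma exists_section (i : Fin (r + 1)) {n : ℕ} {a : MvPolynomial (Fin (r + 1)) k}
    (ha : a ∈ homogeneousSubmodule (Fin (r + 1)) k n) :
    ∃ t : Γ(ProjSpace r k, chart r k i), ∀ y (hy : y ∈ chart r k i),
      valueAt y hy t * algebraMap (MvPolynomial (Fin (r + 1)) k) (LocAt y) (X i ^ n) =
        algebraMap (MvPolynomial (Fin (r + 1)) k) (LocAt y) a :=
  ⟨_, valueAt_awayToSection i n a (by simpa using ha)⟩

/-- Every section over a standard chart is of the form `a / x_i ^ n`. -/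
lemma section_eq_fraction (i : Fin (r + 1)) (t : Γ(ProjSpace r k, chart r k i)) :
    ∃ n, ∃ a ∈ homogeneousSubmodule (Fin (r + 1)) k n, ∀ y (hy : y ∈ chart r k i),
      valueAt y hy t * algebraMap (MvPolynomial (Fin (r + 1)) k) (LocAt y) (X i ^ n) =
        algebraMap (MvPolynomial (Fin (r + 1)) k) (LocAt y) a := by
  let e := Proj.basicOpenIsoAway (homogeneousSubmodule (Fin (r + 1)) k) (X i)
    (X_mem_homogeneousSubmodule i) one_pos
  obtain ⟨n, a, ha, h⟩ := HomogeneousLocalization.Away.mk_surjective _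
    (X_mem_homogeneousSubmodule i) (e.inv t)
  refine ⟨n, a, by simpa using ha, fun y hy => ?_⟩
  have ht : t = (Proj.awayToSection (homogeneousSubmodule (Fin (r + 1)) k) (X i)).hom
      (HomogeneousLocalization.Away.mk _ (X_mem_homogeneousSubmodule i) n a ha) := by
    rw [h]
    exact (e.inv_hom_id_apply t).symm
  rw [ht]
  exact valueAt_awayToSection i n a ha y hy

lemma isUnit_germ_of_isUnit_apply
    (U : TopologicalSpace.Opens
      (ProjectiveSpectrum.top (homogeneousSubmodule (Fin (r + 1)) k)))
    (x : ProjectiveSpectrum.top (homogeneousSubmodule (Fin (r + 1)) k)) (hx : x ∈ U)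
    (s : (ProjectiveSpectrum.Proj.structureSheaf
      (homogeneousSubmodule (Fin (r + 1)) k)).1.obj (Opposite.op U))
    (hs : IsUnit (s.1 ⟨x, hx⟩)) :
    IsUnit ((ProjectiveSpectrum.Proj.structureSheaf
      (homogeneousSubmodule (Fin (r + 1)) k)).presheaf.germ U x hx s) := by
  refine (MulEquiv.isUnit_map (Proj.stalkIso' _ x)).1 ?_
  rw [Proj.stalkIso'_germ]
  exact hs

/-- A function that vanishes on `Z` has a non-unit value at the points of `Z`. -/
lemma not_isUnit_valueAt {Z : Scheme.{u}} {ι : Z ⟶ ProjSpace r k} {U : (ProjSpace r k).Opens}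
    {t : Γ(ProjSpace r k, U)} (ht : t ∈ idealSections ι U) (z : Z) (hz : ι z ∈ U) :
    ¬ IsUnit (valueAt (ι z) hz t) := by
  intro hu
  have h1 := (HomogeneousLocalization.isUnit_iff_isUnit_val
    (homogeneousSubmodule (Fin (r + 1)) k) (primeAt (ι z)) _).1 hu
  have h2 : IsUnit ((ProjSpace r k).presheaf.germ U (ι z) hz t) :=
    isUnit_germ_of_isUnit_apply U (ι z) hz t h1
  have h3 : z ∈ ι ⁻¹ᵁ (ProjSpace r k).basicOpen t := (Scheme.mem_basicOpen _ _ _ hz).2 h2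
  have h4 : (ι.app U) t = 0 := ht
  rw [Scheme.preimage_basicOpen, h4, Scheme.basicOpen_zero] at h3
  exact h3

lemma mem_span_range_X_iff {f : MvPolynomial (Fin (r + 1)) k} :
    f ∈ Ideal.span (Set.range X) ↔ coeff 0 f = 0 := by
  have := mem_pow_idealOfVars_iff' (σ := Fin (r + 1)) (R := k) 1 f
  rw [pow_one] at this
  rw [this]
  refine ⟨fun h => h 0 (by simp), fun h d hd => ?_⟩
  have : d = 0 := by
    rw [← Finsupp.degree_eq_zero_iff]
    omega
  rwa [this]

lemma exists_mem_chart (y : ProjSpace r k) : ∃ i, y ∈ chart r k i := by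
  by_contra! h
  refine y.not_irrelevant_le ?_
  intro f hf
  have hX : Ideal.span (Set.range X) ≤ primeAt y := by
    rw [Ideal.span_le]
    rintro _ ⟨i, rfl⟩
    by_contra hi
    exact h i hi
  refine hX ?_
  have hf0 : coeff 0 f = 0 := by
    have h1 : homogeneousComponent 0 f = 0 :=
      (decomposition.decompose'_apply f 0).symm.trans
        ((HomogeneousIdeal.mem_irrelevant_iff _ f).1 hf)
    rwa [homogeneousComponent_zero, C_eq_zero] at h1
  exact mem_span_range_X_iff.2 hf0

/-- On a chart `f = t x_i^n` with `t` in the ideal sheaf. If `f` were a unit at a point of `Z`, so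
would be `t`, yet `t` restricts to zero on `Z`. -/
lemma mem_primeAt_of_vanishesOn {Z : Scheme.{u}} {ι : Z ⟶ ProjSpace r k} {n : ℕ}
    {f : MvPolynomial (Fin (r + 1)) k} (hf : VanishesOn ι n f) (z : Z) : f ∈ primeAt (ι z) := by
  obtain ⟨i, hi⟩ := exists_mem_chart (ι z)
  obtain ⟨t, ht, h⟩ := hf i
  by_contra hfz
  refine not_isUnit_valueAt ht z hi ?_
  refine isUnit_of_mul_isUnit_left
    (y := algebraMap (MvPolynomial (Fin (r + 1)) k) (LocAt (ι z)) (X i ^ n)) ?_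
  rw [← h (ι z) hi]
  exact IsLocalization.map_units (M := (primeAt (ι z)).primeCompl) (LocAt (ι z)) ⟨f, hfz⟩

lemma homogeneousIdealOf_le_primeAt {Z : Scheme.{u}} (ι : Z ⟶ ProjSpace r k) (z : Z) :
    homogeneousIdealOf ι ≤ primeAt (ι z) := by
  rw [homogeneousIdealOf, Ideal.span_le]
  rintro f ⟨n, -, hf⟩
  exact mem_primeAt_of_vanishesOn hf z

lemma VanishesOn.mul {Z : Scheme.{u}} {ι : Z ⟶ ProjSpace r k} {m n : ℕ}
    {f g : MvPolynomial (Fin (r + 1)) k} (hg : g ∈ homogeneousSubmodule (Fin (r + 1)) k m)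
    (hf : VanishesOn ι n f) : VanishesOn ι (m + n) (g * f) := by
  intro i
  obtain ⟨t, ht, h⟩ := hf i
  obtain ⟨t', h'⟩ := exists_section i hg
  refine ⟨t' * t, Ideal.mul_mem_left _ _ ht, fun y hy => ?_⟩
  have h1 := h y hy
  dsimp only at h1 ⊢
  rw [map_mul, h1, ← h' y hy, pow_add, map_mul, map_mul]
  ring

lemma homogeneousComponent_succ_X_mul (i : Fin (r + 1)) (n : ℕ)
    (f : MvPolynomial (Fin (r + 1)) k) :
    homogeneousComponent (n + 1) (X i * f) = X i * homogeneousComponent n f := by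
  ext d
  rw [coeff_homogeneousComponent, coeff_X_mul', coeff_X_mul', coeff_homogeneousComponent]
  by_cases hd : i ∈ d.support
  · have hdeg : d.degree = (d - Finsupp.single i 1).degree + 1 := by
      have h1 : d - Finsupp.single i 1 + Finsupp.single i 1 = d :=
        tsub_add_cancel_of_le (Finsupp.single_le_iff.2
          (Nat.one_le_iff_ne_zero.2 (Finsupp.mem_support_iff.1 hd)))
      conv_lhs => rw [← h1, map_add, Finsupp.degree_single]
    simp [hd, hdeg]
  · simp [hd]

lemma homogeneousComponent_zero_X_mul (i : Fin (r + 1)) (f : MvPolynomial (Fin (r + 1)) k) :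
    homogeneousComponent 0 (X i * f) = 0 := by
  rw [homogeneousComponent_zero, coeff_X_mul']
  simp

lemma VanishesOn.add {Z : Scheme.{u}} {ι : Z ⟶ ProjSpace r k} {n : ℕ}
    {f g : MvPolynomial (Fin (r + 1)) k} (hf : VanishesOn ι n f) (hg : VanishesOn ι n g) :
    VanishesOn ι n (f + g) := by
  have := add_mem hf hg
  unfold VanishesOn
  convert this using 1
  ext y
  simp

lemma vanishesOn_zero {Z : Scheme.{u}} (ι : Z ⟶ ProjSpace r k) (n : ℕ) : VanishesOn ι n 0 := by
  have := zero_mem (twistedIdealSections ι n)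
  unfold VanishesOn
  convert this using 1
  ext y
  simp

/-- The ideal is generated by forms, and multiplying by a constant or a variable only shifts
components. Hence the degree `n` part of the ideal consists exactly of the vanishing forms of degree
`n`. -/
lemma vanishesOn_homogeneousComponent {Z : Scheme.{u}} {ι : Z ⟶ ProjSpace r k}
    {f : MvPolynomial (Fin (r + 1)) k} (hf : f ∈ homogeneousIdealOf ι) (n : ℕ) :
    VanishesOn ι n (homogeneousComponent n f) := by
  induction hf using Submodule.span_induction generalizing n with
  | mem f h =>
    obtain ⟨m, hm, hv⟩ := h
    rw [homogeneousComponent_of_mem hm]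
    split_ifs with hmn
    · exact hmn ▸ hv
    · exact vanishesOn_zero ι n
  | zero => simpa using vanishesOn_zero ι n
  | add f g _ _ hf hg => rw [map_add]; exact (hf n).add (hg n)
  | smul a f _ h =>
    rw [smul_eq_mul]
    induction a using MvPolynomial.induction_on generalizing n with
    | C c =>
      rw [homogeneousComponent_C_mul]
      have := (h n).mul (m := 0) (g := C c) (isHomogeneous_C _ _)
      rwa [zero_add] at this
    | add p q hp hq => rw [add_mul, map_add]; exact (hp n).add (hq n)
    | mul_X p i hp =>
      rw [mul_comm p, mul_assoc]
      cases n with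
      | zero => rw [homogeneousComponent_zero_X_mul]; exact vanishesOn_zero ι 0
      | succ n =>
        rw [homogeneousComponent_succ_X_mul, add_comm n 1]
        exact (hp n).mul (X_mem_homogeneousSubmodule i)

lemma mem_homogeneousIdealOf_iff {Z : Scheme.{u}} {ι : Z ⟶ ProjSpace r k} {n : ℕ}
    {f : MvPolynomial (Fin (r + 1)) k} (hf : f ∈ homogeneousSubmodule (Fin (r + 1)) k n) :
    f ∈ homogeneousIdealOf ι ↔ VanishesOn ι n f := by
  refine ⟨fun h => ?_, fun h => Ideal.subset_span ⟨n, hf, h⟩⟩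
  have := vanishesOn_homogeneousComponent h n
  rwa [homogeneousComponent_eq_self hf] at this

lemma homogeneousComponent_mem_homogeneousIdealOf {Z : Scheme.{u}} {ι : Z ⟶ ProjSpace r k}
    {f : MvPolynomial (Fin (r + 1)) k} (hf : f ∈ homogeneousIdealOf ι) (n : ℕ) :
    homogeneousComponent n f ∈ homogeneousIdealOf ι :=
  Ideal.subset_span ⟨n, homogeneousComponent_mem n f, vanishesOn_homogeneousComponent hf n⟩

/-! ### Global sections of `𝒪(n)` are forms. -/

/-- The generic point of projective space. -/
def genericPt (r : ℕ) (k : Type u) [Field k] : ProjSpace r k where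
  asHomogeneousIdeal := ⊥
  isPrime := by
    rw [HomogeneousIdeal.toIdeal_bot]
    exact Ideal.isPrime_bot
  not_irrelevant_le h := by
    have := h (HomogeneousIdeal.mem_irrelevant_of_mem _ one_pos
      (X_mem_homogeneousSubmodule (k := k) (0 : Fin (r + 1))))
    exact X_ne_zero (R := k) (0 : Fin (r + 1)) ((Submodule.mem_bot _).1 this)

lemma primeAt_genericPt : primeAt (genericPt r k) = ⊥ := HomogeneousIdeal.toIdeal_bot

lemma genericPt_mem_chart (i : Fin (r + 1)) : genericPt r k ∈ chart r k i := by
  change X i ∉ primeAt (genericPt r k)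
  rw [primeAt_genericPt]
  exact X_ne_zero i

lemma algebraMap_genericPt_injective :
    Function.Injective (algebraMap (MvPolynomial (Fin (r + 1)) k) (LocAt (genericPt r k))) := by
  refine IsLocalization.injective _ (M := (primeAt (genericPt r k)).primeCompl) ?_
  intro f hf
  refine mem_nonZeroDivisors_of_ne_zero fun h => hf ?_
  rw [h]
  exact zero_mem _

/-- Every global section of the twisted sheaf is a form. -/
lemma exists_form_of_mem_twistedIdealSections (hr : 1 ≤ r) {Z : Scheme.{u}}
    {ι : Z ⟶ ProjSpace r k} {n : ℕ} {s : ∀ y : ProjSpace r k, LocAt y}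
    (hs : s ∈ twistedIdealSections ι n) :
    ∃ f ∈ homogeneousSubmodule (Fin (r + 1)) k n,
      s = fun y => algebraMap (MvPolynomial (Fin (r + 1)) k) (LocAt y) f := by
  have h1 : ∀ i, ∃ N, ∃ a ∈ homogeneousSubmodule (Fin (r + 1)) k N, ∀ y, y ∈ chart r k i →
      s y * algebraMap (MvPolynomial (Fin (r + 1)) k) (LocAt y) (X i ^ N) =
        algebraMap (MvPolynomial (Fin (r + 1)) k) (LocAt y) (a * X i ^ n) := by
    intro i
    obtain ⟨t, -, ht⟩ := hs i
    obtain ⟨N, a, ha, h⟩ := section_eq_fraction i t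
    refine ⟨N, a, ha, fun y hy => ?_⟩
    rw [ht y hy, map_mul _ a, ← h y hy]
    ring
  choose N a ha h using h1
  -- compare two charts at the generic point
  have key : ∀ i j, a i * X i ^ n * X j ^ N j = a j * X j ^ n * X i ^ N i := by
    intro i j
    refine algebraMap_genericPt_injective ?_
    rw [map_mul, map_mul (y := X i ^ N i), ← h i _ (genericPt_mem_chart i),
      ← h j _ (genericPt_mem_chart j)]
    ring
  have hdvd : (X 0 ^ N 0 : MvPolynomial (Fin (r + 1)) k) ∣ a 0 * X 0 ^ n := by
    -- Here `1 ≤ r` matters: two distinct variables are needed for coprime denominators.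
    have hne : (0 : Fin (r + 1)) ≠ Fin.last r := by
      rw [Ne, Fin.ext_iff]
      simp
      omega
    have hrel : IsRelPrime (X 0 ^ N 0 : MvPolynomial (Fin (r + 1)) k)
        (X (Fin.last r) ^ N (Fin.last r)) := by
      refine IsRelPrime.pow ?_
      have hp : Prime (X 0 : MvPolynomial (Fin (r + 1)) k) := X_prime
      rw [hp.irreducible.isRelPrime_iff_not_dvd, X_dvd_X]
      exact hne
    refine hrel.dvd_of_dvd_mul_right ⟨a (Fin.last r) * X (Fin.last r) ^ n, ?_⟩
    rw [key 0 (Fin.last r)]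
    ring
  obtain ⟨f, hf⟩ := hdvd
  have hX : ∀ i, (X i : MvPolynomial (Fin (r + 1)) k) ≠ 0 := fun i => X_ne_zero i
  have hfi : ∀ i, a i * X i ^ n = X i ^ N i * f := by
    intro i
    refine mul_right_cancel₀ (pow_ne_zero (N 0) (hX 0)) ?_
    rw [← key 0 i, hf]
    ring
  have hfn : f ∈ homogeneousSubmodule (Fin (r + 1)) k n := by
    have hdeg : (X 0 ^ N 0 * f).IsHomogeneous (N 0 + n) := by
      rw [← hf]
      exact IsHomogeneous.mul (ha 0) (isHomogeneous_X_pow 0 n)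
    intro d hd
    have h2 : coeff (Finsupp.single 0 (N 0) + d) (X 0 ^ N 0 * f) ≠ 0 := by
      rwa [X_pow_eq_monomial, coeff_monomial_mul, one_mul]
    have h3 := hdeg h2
    rw [map_add, Finsupp.weight_single] at h3
    simpa using h3
  refine ⟨f, hfn, funext fun y => ?_⟩
  obtain ⟨i, hi⟩ := exists_mem_chart y
  refine ((isUnit_X hi).pow (N i)).mul_right_cancel ?_
  rw [← map_pow, h i y hi, hfi i, map_mul]
  ring

/-! ### Dimension counts -/

/-- The monomials of degree `n` are a basis of the forms of degree `n`. -/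
def homogeneousSubmoduleBasis (r : ℕ) (k : Type u) [Field k] (n : ℕ) :
    Module.Basis ((Finset.univ : Finset (Fin (r + 1))).finsuppAntidiag n) k
      (homogeneousSubmodule (Fin (r + 1)) k n) :=
  ((basisRestrictSupport k {d : Fin (r + 1) →₀ ℕ | d.degree = n}).map
    (LinearEquiv.ofEq _ _
      (homogeneousSubmodule_eq_finsupp_supported (Fin (r + 1)) k n).symm)).reindex
    (Equiv.subtypeEquivRight fun d => by
      simp [Finset.mem_finsuppAntidiag, Finsupp.degree_eq_sum])

lemma finrank_homogeneousSubmodule (n : ℕ) :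
    Module.finrank k (homogeneousSubmodule (Fin (r + 1)) k n) = (r + n).choose n := by
  rw [Module.finrank_eq_card_basis (homogeneousSubmoduleBasis r k n), Fintype.card_coe,
    Finset.card_finsuppAntidiag_nat_eq_choose]
  congr 1
  simp

instance (n : ℕ) : FiniteDimensional k (homogeneousSubmodule (Fin (r + 1)) k n) :=
  .of_basis (homogeneousSubmoduleBasis r k n)

/-- A form as a family of elements of the localizations. -/
def evalAll (r : ℕ) (k : Type u) [Field k] :
    MvPolynomial (Fin (r + 1)) k →ₗ[k] ∀ y : ProjSpace r k, LocAt y :=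
  LinearMap.pi fun y => (Algebra.linearMap (MvPolynomial (Fin (r + 1)) k) (LocAt y)).restrictScalars k

lemma evalAll_injective : Function.Injective (evalAll r k) := fun _ _ h =>
  algebraMap_genericPt_injective (congrFun h (genericPt r k))

variable {Z : Scheme.{u}} (ι : Z ⟶ ProjSpace r k)

/-- The forms of degree `n` in the homogeneous ideal of `Z`. -/
def formsOfDegree (n : ℕ) : Submodule k (MvPolynomial (Fin (r + 1)) k) :=
  homogeneousSubmodule (Fin (r + 1)) k n ⊓ (homogeneousIdealOf ι).restrictScalars k

lemma twistedIdealSections_eq_map (hr : 1 ≤ r) (n : ℕ) :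
    twistedIdealSections ι n = (formsOfDegree ι n).map (evalAll r k) := by
  ext s
  constructor
  · intro hs
    obtain ⟨f, hf, rfl⟩ := exists_form_of_mem_twistedIdealSections hr hs
    exact ⟨f, ⟨hf, (mem_homogeneousIdealOf_iff hf).2 hs⟩, rfl⟩
  · rintro ⟨f, ⟨hf, hI⟩, rfl⟩
    exact (mem_homogeneousIdealOf_iff hf).1 hI

lemma h0TwistedIdeal_eq_finrank (hr : 1 ≤ r) (n : ℕ) :
    h0TwistedIdeal ι n = Module.finrank k (formsOfDegree ι n) := by
  rw [h0TwistedIdeal, twistedIdealSections_eq_map ι hr]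
  exact (LinearEquiv.finrank_eq (Submodule.equivMapOfInjective _ evalAll_injective _)).symm

/-- The part of degree `n` of the coordinate ring. -/
abbrev coordinateRingPart (n : ℕ) : Submodule k (CoordinateRing ι) :=
  (homogeneousSubmodule (Fin (r + 1)) k n).map
    (Ideal.Quotient.mkₐ k (homogeneousIdealOf ι)).toLinearMap

lemma hilbertFunction_add_finrank (n : ℕ) :
    hilbertFunction ι n + Module.finrank k (formsOfDegree ι n) = (r + n).choose n := by
  let φ := (Ideal.Quotient.mkₐ k (homogeneousIdealOf ι)).toLinearMap.domRestrict
    (homogeneousSubmodule (Fin (r + 1)) k n)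
  have h := LinearMap.finrank_range_add_finrank_ker φ
  rw [finrank_homogeneousSubmodule] at h
  rw [← h, hilbertFunction]
  congr 1
  · rw [LinearMap.range_domRestrict]
  · have hk : formsOfDegree ι n = (LinearMap.ker φ).map (Submodule.subtype _) := by
      ext f
      simp only [formsOfDegree, Submodule.mem_inf, Submodule.restrictScalars_mem,
        Submodule.mem_map, Submodule.subtype_apply]
      constructor
      · rintro ⟨hf, hI⟩
        exact ⟨⟨f, hf⟩, Ideal.Quotient.eq_zero_iff_mem.2 hI, rfl⟩
      · rintro ⟨g, hg, rfl⟩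
        exact ⟨g.2, Ideal.Quotient.eq_zero_iff_mem.1 hg⟩
    rw [hk]
    exact (LinearEquiv.finrank_eq (Submodule.equivMapOfInjective _
      (Submodule.subtype_injective _) _)).symm

/-- The projection of the coordinate ring onto its part of degree `n`. -/
def coordinateRingProj (n : ℕ) : CoordinateRing ι →ₗ[k] CoordinateRing ι where
  toFun := Quotient.lift
    (fun f => Ideal.Quotient.mk (homogeneousIdealOf ι) (homogeneousComponent n f))
    (fun f g h => by
      rw [Ideal.Quotient.eq, ← map_sub]
      exact homogeneousComponent_mem_homogeneousIdealOf
        ((Submodule.quotientRel_def _).1 h) n)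
  map_add' a b := by
    obtain ⟨a, rfl⟩ := Ideal.Quotient.mk_surjective a
    obtain ⟨b, rfl⟩ := Ideal.Quotient.mk_surjective b
    change Ideal.Quotient.mk _ (homogeneousComponent n (a + b)) = _
    rw [map_add, map_add]
    rfl
  map_smul' c a := by
    obtain ⟨a, rfl⟩ := Ideal.Quotient.mk_surjective a
    change Ideal.Quotient.mk _ (homogeneousComponent n (c • a)) = _
    rw [map_smul]
    rfl

lemma coordinateRingProj_mk (n : ℕ) (f : MvPolynomial (Fin (r + 1)) k) :
    coordinateRingProj ι n (Ideal.Quotient.mk _ f) =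
      Ideal.Quotient.mk _ (homogeneousComponent n f) := rfl

/-- The coordinates as elements of the homogeneous coordinate ring. -/
abbrev coord (i : Fin (r + 1)) : CoordinateRing ι := Ideal.Quotient.mk _ (X i)

lemma coord_mul_mem (n : ℕ) (i : Fin (r + 1)) (a : CoordinateRing ι)
    (ha : a ∈ coordinateRingPart ι n) : coord ι i * a ∈ coordinateRingPart ι (n + 1) := by
  obtain ⟨f, hf, rfl⟩ := ha
  refine ⟨X i * f, ?_, map_mul (Ideal.Quotient.mk _) _ _⟩
  rw [add_comm n]
  exact IsHomogeneous.mul (isHomogeneous_X k i) hf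

/-- The rank inequality for three consecutive graded parts, with the projections to degrees `n` and
`n + 1` as `p` and `q`. -/
theorem hilbertFunction_convex (h : KoszulDepthTwo (coord ι)) (n : ℕ) :
    2 * hilbertFunction ι (n + 1) ≤ hilbertFunction ι (n + 2) + hilbertFunction ι n := by
  refine two_mul_finrank_le h (coordinateRingPart ι n) (coordinateRingPart ι (n + 1))
    (coordinateRingPart ι (n + 2)) (coord_mul_mem ι n) (coord_mul_mem ι (n + 1))
    (coordinateRingProj ι n) (coordinateRingProj ι (n + 1)) ?_ ?_ ?_
  · intro a
    obtain ⟨f, rfl⟩ := Ideal.Quotient.mk_surjective a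
    exact ⟨homogeneousComponent n f, homogeneousComponent_mem n f, rfl⟩
  · rintro _ ⟨f, hf, rfl⟩
    change Ideal.Quotient.mk _ (homogeneousComponent (n + 1) f) = _
    rw [homogeneousComponent_eq_self hf]
    rfl
  · intro i a
    obtain ⟨f, rfl⟩ := Ideal.Quotient.mk_surjective a
    rw [← map_mul, coordinateRingProj_mk, coordinateRingProj_mk,
      homogeneousComponent_succ_X_mul, map_mul]

/-- Slopes increase and are eventually 8, so they never exceed 8. Thus the excess `H n - (8n - 3)`
decreases to its eventual value 0 and is nonnegative at 2, while `H 2 ≤ H 1 + 8`. -/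
lemma eq_thirteen_of_convex {H : ℕ → ℕ} (hconv : ∀ n, 2 * H (n + 1) ≤ H (n + 2) + H n)
    (h1 : H 1 ≤ 5) {N : ℕ} (hN : ∀ n ≥ N, (H n : ℤ) = 8 * n - 3) : H 2 = 13 := by
  have hmono : Monotone fun n => (H (n + 1) : ℤ) - H n :=
    monotone_nat_of_le_succ fun n => by have : 2 * H (n + 1) ≤ H (n + 1 + 1) + H n := hconv n; omega
  have hslope : ∀ n, (H (n + 1) : ℤ) - H n ≤ 8 := by
    intro n
    refine (hmono (le_max_left n N)).trans ?_
    have h2 := hN (max n N) (le_max_right n N)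
    have h3 := hN (max n N + 1) (by omega)
    dsimp only
    push_cast at h3
    omega
  have hanti : Antitone fun n => (H n : ℤ) - (8 * n - 3) :=
    antitone_nat_of_succ_le fun n => by have := hslope n; push_cast; omega
  have h2 : (H 2 : ℤ) - (8 * (2 : ℕ) - 3) ≥ 0 := by
    refine le_trans ?_ (hanti (le_max_left 2 N))
    have := hN (max 2 N) (le_max_right 2 N)
    dsimp only
    omega
  have h3 := hslope 1
  norm_num at h2 h3
  omega

/-! ### Depth of the coordinate ring -/

/-- An element with nonzero constant term would put a unit, its degree zero component, into the
homogeneous prime. -/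
lemma primeAt_le_span_range_X (y : ProjSpace r k) : primeAt y ≤ Ideal.span (Set.range X) := by
  intro f hf
  rw [mem_span_range_X_iff]
  by_contra h0
  have h1 : homogeneousComponent 0 f ∈ primeAt y :=
    homogeneousComponent_mem_of_mem y.asHomogeneousIdeal.isHomogeneous hf 0
  rw [homogeneousComponent_zero] at h1
  exact (isPrime_primeAt y).ne_top (Ideal.eq_top_of_isUnit_mem _ h1
    ((isUnit_iff_ne_zero.2 h0).map C))

lemma primeAt_lt_span_range_X (y : ProjSpace r k) : primeAt y < Ideal.span (Set.range X) := by
  refine lt_of_le_of_ne (primeAt_le_span_range_X y) fun h => ?_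
  obtain ⟨i, hi⟩ := exists_mem_chart y
  exact X_notMem_primeAt hi (h ▸ Ideal.subset_span ⟨i, rfl⟩)

lemma isMaximal_span_range_X :
    (Ideal.span (Set.range (X : Fin (r + 1) → MvPolynomial (Fin (r + 1)) k))).IsMaximal := by
  have : Ideal.span (Set.range (X : Fin (r + 1) → MvPolynomial (Fin (r + 1)) k)) =
      RingHom.ker (constantCoeff : MvPolynomial (Fin (r + 1)) k →+* k) := by
    ext f
    rw [mem_span_range_X_iff, RingHom.mem_ker, constantCoeff_eq]
  rw [this]
  exact RingHom.ker_isMaximal_of_surjective _ fun c => ⟨C c, constantCoeff_C _ c⟩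

/-- A one-dimensional scheme has a point with a proper specialization. -/
lemma exists_specializes_of_dim {Z : Scheme.{u}} (h : topologicalKrullDim Z = 1) :
    ∃ z w : Z, z ⤳ w ∧ z ≠ w := by
  have h1 : ((1 : ℕ) : WithBot ℕ∞) ≤ Order.krullDim (TopologicalSpace.IrreducibleCloseds Z) :=
    h.symm.le
  rw [Order.le_krullDim_iff] at h1
  obtain ⟨l, hl⟩ := h1
  have hlt : l 0 < l (Fin.last _) := l.strictMono (by rw [Fin.lt_def]; simp [hl])
  -- The generic point of the larger closed set specializes to that of the smaller.
  obtain ⟨z, hz⟩ := QuasiSober.sober (l (Fin.last _)).isIrreducible (l (Fin.last _)).isClosed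
  obtain ⟨w, hw⟩ := QuasiSober.sober (l 0).isIrreducible (l 0).isClosed
  refine ⟨z, w, ?_, ?_⟩
  · rw [specializes_iff_mem_closure, hz.def]
    exact hlt.le hw.mem
  · rintro rfl
    exact hlt.ne (TopologicalSpace.IrreducibleCloseds.ext (hw.def.symm.trans hz.def))

lemma primeAt_le_of_specializes {x y : ProjSpace r k} (h : x ⤳ y) : primeAt x ≤ primeAt y :=
  (ProjectiveSpectrum.le_iff_mem_closure _ x y).2 (specializes_iff_mem_closure.1 h)

lemma primeAt_injective {x y : ProjSpace r k} (h : primeAt x = primeAt y) : x = y :=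
  ProjectiveSpectrum.ext (HomogeneousIdeal.toIdeal_injective h)

/-- The irrelevant ideal of the coordinate ring. -/
abbrev irrelevantIdeal : Ideal (CoordinateRing ι) := Ideal.span (Set.range (coord ι))

lemma irrelevantIdeal_eq_map :
    irrelevantIdeal ι =
      (Ideal.span (Set.range X)).map (Ideal.Quotient.mk (homogeneousIdealOf ι)) := by
  rw [Ideal.map_span, ← Set.range_comp]
  rfl

lemma isMaximal_irrelevantIdeal (z : Z) : (irrelevantIdeal ι).IsMaximal := by
  rw [irrelevantIdeal_eq_map]
  have := isMaximal_span_range_X (r := r) (k := k)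
  refine Ideal.IsMaximal.map_of_surjective_of_ker_le Ideal.Quotient.mk_surjective ?_
  rw [Ideal.mk_ker]
  exact (homogeneousIdealOf_le_primeAt ι z).trans (primeAt_le_span_range_X _)

lemma map_mk_lt {I p q : Ideal (MvPolynomial (Fin (r + 1)) k)} (hI : I ≤ p) (h : p < q) :
    p.map (Ideal.Quotient.mk I) < q.map (Ideal.Quotient.mk I) := by
  refine lt_of_le_of_ne (Ideal.map_mono h.le) fun he => h.ne ?_
  have := congrArg (Ideal.comap (Ideal.Quotient.mk I)) he
  rwa [Ideal.comap_map_mk hI, Ideal.comap_map_mk (hI.trans h.le)] at this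

/-- Passing to the cone adds one dimension: a proper specialization from `z` to `w` in `Z` gives the
chain of primes of `z`, of `w`, and the irrelevant ideal. -/
lemma two_le_height_irrelevantIdeal [IsClosedImmersion ι] (h : topologicalKrullDim Z = 1) :
    2 ≤ (irrelevantIdeal ι).height := by
  obtain ⟨z, w, hzw, hne⟩ := exists_specializes_of_dim h
  have hmax := isMaximal_irrelevantIdeal ι z
  have hprime (v : Z) :
      ((primeAt (ι v)).map (Ideal.Quotient.mk (homogeneousIdealOf ι))).IsPrime :=
    Ideal.map_isPrime_of_surjective Ideal.Quotient.mk_surjective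
      (by rw [Ideal.mk_ker]; exact homogeneousIdealOf_le_primeAt ι v)
  have hlt : primeAt (ι z) < primeAt (ι w) := by
    refine lt_of_le_of_ne (primeAt_le_of_specializes (hzw.map ι.continuous)) fun he => hne ?_
    exact (Scheme.Hom.isClosedEmbedding ι).injective (primeAt_injective he)
  have h1 := map_mk_lt (homogeneousIdealOf_le_primeAt ι z) hlt
  have h2 := map_mk_lt (homogeneousIdealOf_le_primeAt ι w) (primeAt_lt_span_range_X (ι w))
  rw [← irrelevantIdeal_eq_map] at h2
  have := hprime z
  have := hprime w
  have h3 := Ideal.height_add_one_le_of_lt_of_isPrime h1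
  have h4 := Ideal.height_add_one_le_of_lt_of_isPrime h2
  calc (2 : ℕ∞) = 0 + 1 + 1 := by norm_num
    _ ≤ _ := le_trans (by gcongr; exact le_trans (by gcongr; exact zero_le) h3) h4

/-- A regular sequence of length at least two, spelled out for its first two members. -/
lemma exists_regular_pair {R : Type*} [CommRing R] {rs : List R}
    (h : RingTheory.Sequence.IsWeaklyRegular R rs) (hlen : 2 ≤ rs.length) :
    ∃ a ∈ rs, ∃ b ∈ rs, (∀ c, a * c = 0 → c = 0) ∧ ∀ c, a ∣ b * c → a ∣ c := by
  match rs, hlen with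
  | a :: b :: rs, _ =>
    rw [RingTheory.Sequence.isWeaklyRegular_cons_iff,
      RingTheory.Sequence.isWeaklyRegular_cons_iff] at h
    refine ⟨a, by simp, b, by simp, fun c hc => ?_, fun c hc => ?_⟩
    · exact h.1 (by simpa using hc)
    · have key (d : R) : (Submodule.Quotient.mk d : QuotSMulTop a R) = 0 ↔ a ∣ d := by
        rw [Submodule.Quotient.mk_eq_zero, Submodule.mem_smul_pointwise_iff_exists]
        simp [dvd_def, eq_comm]
      rw [← key]
      refine h.2.1 ?_
      dsimp only
      rw [smul_zero, ← Submodule.Quotient.mk_smul, key]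
      exact hc

/-- Localize at the irrelevant ideal: a regular sequence as long as the height has at least two
members, which lie in the ideal generated by the coordinates, and the vanishing descends to the ring
itself. -/
theorem koszulDepthTwo_of_isACM [IsClosedImmersion ι] (h : topologicalKrullDim Z = 1)
    (hACM : IsACM ι) : KoszulDepthTwo (coord ι) := by
  obtain ⟨z, -⟩ := exists_specializes_of_dim h
  have hmax := isMaximal_irrelevantIdeal ι z
  obtain ⟨-, rs, hrs, hreg, hlen⟩ := hACM.localization (irrelevantIdeal ι)
  have h2 : 2 ≤ rs.length := by
    rw [IsLocalization.AtPrime.ringKrullDim_eq_height (irrelevantIdeal ι)] at hlen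
    have := two_le_height_irrelevantIdeal ι h
    have h3 : ((2 : ℕ∞) : WithBot ℕ∞) ≤ ((rs.length : ℕ) : WithBot ℕ∞) :=
      hlen ▸ WithBot.coe_le_coe.2 this
    exact_mod_cast h3
  obtain ⟨a, ha, b, hb, hab⟩ := exists_regular_pair hreg.toIsWeaklyRegular h2
  have hspan : IsLocalRing.maximalIdeal (Localization.AtPrime (irrelevantIdeal ι)) =
      Ideal.span (Set.range fun i => algebraMap (CoordinateRing ι)
        (Localization.AtPrime (irrelevantIdeal ι)) (coord ι i)) := by
    rw [← Localization.AtPrime.map_eq_maximalIdeal, Ideal.map_span, ← Set.range_comp]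
    rfl
  exact .of_localization (irrelevantIdeal ι) rfl
    (.of_regular (hspan ▸ hrs a ha) (hspan ▸ hrs b hb) hab.1 hab.2)

/-! ### Hypersurfaces -/

/-- The charts are affine, and on affine opens the ideal of the scheme-theoretic image is the kernel
of `ι.app`, so the same local section works. -/
lemma VanishesOn.imageι [QuasiCompact ι] {n : ℕ} {f : MvPolynomial (Fin (r + 1)) k}
    (hf : VanishesOn ι n f) : VanishesOn ι.ker.subschemeι n f := by
  intro i
  obtain ⟨t, ht, h⟩ := hf i
  refine ⟨t, ?_, h⟩
  have haff : IsAffineOpen (chart r k i) :=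
    Proj.isAffineOpen_basicOpen _ _ (X_mem_homogeneousSubmodule i) one_pos
  have hker := ι.ker.ker_subschemeι_app ⟨chart r k i, haff⟩
  rw [idealSections, hker, Scheme.Hom.ker_apply]
  exact ht

/-- The kernel of `ι` belongs to the family whose infimum defines `V(q)`, so the image of `ι` is a
closed subscheme of `V(q)`. -/
lemma liesOnHypersurface_of_vanishesOn [QuasiCompact ι] {n : ℕ}
    {q : MvPolynomial (Fin (r + 1)) k} (hq : q ∈ homogeneousSubmodule (Fin (r + 1)) k n)
    (hq0 : q ≠ 0) (hv : VanishesOn ι n q) : LiesOnHypersurface ι n := by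
  have hle : hypersurface n q ≤ ι.ker := sInf_le hv.imageι
  refine ⟨q, hq, hq0, ι.toImage ≫ Scheme.IdealSheafData.inclusion hle, ?_⟩
  rw [Category.assoc, Scheme.IdealSheafData.inclusion_subschemeι]
  exact ι.toImage_imageι

end ACMCurve

end

/-! ### The main theorem. -/

theorem mainTheorem10 {k : Type*} [Field k] {C : Scheme} (ι : C ⟶ ACMCurve.ProjSpace 4 k)
    (hC : ACMCurve.IsCurve ι 8 4) (hACM : ACMCurve.IsACM ι) :
    ACMCurve.h0TwistedIdeal ι 2 = 2 ∧ ACMCurve.LiesOnHypersurface ι 2 := by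
  have := hC.isClosedImmersion
  have hdepth := ACMCurve.koszulDepthTwo_of_isACM ι hC.dim_eq_one hACM
  have h1 := ACMCurve.hilbertFunction_add_finrank ι 1
  have h2 := ACMCurve.hilbertFunction_add_finrank ι 2
  have hH2 : ACMCurve.hilbertFunction ι 2 = 13 := by
    obtain ⟨N, hN⟩ := Filter.eventually_atTop.1 hC.hilbertPolynomial
    refine ACMCurve.eq_thirteen_of_convex (ACMCurve.hilbertFunction_convex ι hdepth)
      (N := N) ?_ fun n hn => ?_
    -- There are only five linear forms, so `H 1 ≤ 5`.
    · norm_num at h1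
      omega
    · have h3 := hN n hn
      simp only [Polynomial.eval_add, Polynomial.eval_mul, Polynomial.eval_C,
        Polynomial.eval_X] at h3
      have h4 : ((ACMCurve.hilbertFunction ι n : ℤ) : ℚ) = ((8 * n - 3 : ℤ) : ℚ) := by
        push_cast at h3 ⊢
        linarith
      exact_mod_cast h4
  have hrank : Module.finrank k (ACMCurve.formsOfDegree ι 2) = 2 := by
    rw [hH2] at h2
    have : (4 + 2).choose 2 = 15 := rfl
    omega
  refine ⟨by rw [ACMCurve.h0TwistedIdeal_eq_finrank ι (by norm_num), hrank], ?_⟩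
  have hne : ACMCurve.formsOfDegree ι 2 ≠ ⊥ := by
    intro h
    rw [h, finrank_bot] at hrank
    omega
  obtain ⟨q, ⟨hq, hqI⟩, hq0⟩ := Submodule.exists_mem_ne_zero_of_ne_bot hne
  exact ACMCurve.liesOnHypersurface_of_vanishesOn ι hq hq0
    ((ACMCurve.mem_homogeneousIdealOf_iff hq).1 hqI)
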